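/- Let $G$ be a group acting by graph automorphisms and without inversions on a tree $\mathcal{T}$ (no element of $G$ exchanges the two ends of an edge), and let $Y=\mathcal{T}/G$ be the quotient graph (loops and multiple edges are allowed in $Y$). Let $T\subseteq Y$ be a spanning tree, and let $j\colon Y\to\mathcal{T}$ be a section, on vertices and on edges, of the quotient map, such that $j|_{T}$ is an isomorphism of graphs onto its image. Suppose that the two ends of each edge $e$ of $Y$ are ordered as $(v,w)$ and that $g_{e}\in G$ satisfies $j(e)=\{j(v),g_{e}j(w)\}$, with $g_{e}=1$ for every edge $e$ of $T$. For a vertex $v$ of $Y$ let $G_{v}=\mathrm{Stab}_{G}(j(v))$, and for an edge $e$ of $Y$ let $G_{e}=\mathrm{Stab}_{G}(j(e))$. For an edge $e$ with ordered ends $(v,w)$, the edge group embeds in $G_{v}$ by inclusion and in $G_{w}$ by $x\mapsto g_{e}^{-1}xg_{e}$; when an edge group is regarded as a subset of a vertex group, its image under this embedding is meant, and both images if $e$ is a loop. For each vertex $v$ of $Y$ let $S_{v}\subseteq G_{v}$ be a subset, and let \[ K=\Big\langle \{g_{e} : e \text{ an edge of } Y \text{ not in } T\}\cup\bigcup_{v}S_{v}\Big\rangle\le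 G . \] If there is a vertex $v_{0}$ of $Y$ such that \[ \Big\langle S_{v_{0}}\cup\bigcup_{e\ni v_{0}}G_{e}\Big\rangle\lneq G_{v_{0}}\lneq G , \] where the union is over the edges $e$ of $Y$ incident to $v_{0}$, then $[G:K]=\infty$. -/

import Mathlib

universe u v

/-- The action of the group `G` on the vertices of the graph `𝒯` is by graph automorphisms. -/
class ActsOnGraph (G : Type u) [Group G] {X : Type v} [MulAction G X] (𝒯 : SimpleGraph X) :
    Prop where
  adj_smul : ∀ (g : G) {x y : X}, 𝒯.Adj x y → 𝒯.Adj (g • x) (g • y)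

/-- The action of `G` on the graph `𝒯` is without inversions: no element of `G` exchanges the two
ends of an edge. -/
def WithoutInversions (G : Type u) [Group G] {X : Type v} [MulAction G X] (𝒯 : SimpleGraph X) :
    Prop :=
  ∀ (g : G) (x y : X), 𝒯.Adj x y → ¬ (g • x = y ∧ g • y = x)

/-- A multigraph is a tree if it has no loops and no multiple edges and it is a tree as a simple
graph (that is, it is non-empty, connected and without cycles). -/
structure IsMultigraphTree {α : Type u} {β : Type v} (T : Graph α β) : Prop where
  simple : T.Simple
  isTree : T.toSimpleGraph.IsTree

namespace BassSerre

section Quotient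

variable (G : Type u) [Group G] {X : Type v} [MulAction G X] (𝒯 : SimpleGraph X)
  [ActsOnGraph G 𝒯]

/-- The induced action of `G` on the (unoriented) edges of `𝒯`: `g • {x, y} = {g • x, g • y}`. -/
instance edgeAction : MulAction G 𝒯.edgeSet where
  smul g e := ⟨Sym2.map (g • ·) e.1, by
    obtain ⟨e, he⟩ := e
    induction e with
    | h x y => exact ActsOnGraph.adj_smul g he⟩
  one_smul e := Subtype.ext (by
    obtain ⟨e, he⟩ := e
    induction e with
    | h x y => simp [HSMul.hSMul, SMul.smul]
               exact Or.inl ⟨one_smul G x, one_smul G y⟩)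
  mul_smul g h e := Subtype.ext (by
    obtain ⟨e, he⟩ := e
    induction e with
    | h x y => exact congrArg₂ (fun a b => s(a, b)) (mul_smul g h x) (mul_smul g h y))

/-- The vertices of the quotient graph: the `G`-orbits of vertices. -/
abbrev VertexOrbit (G : Type u) [Group G] (X : Type v) [MulAction G X] : Type v :=
  MulAction.orbitRel.Quotient G X

/-- The edges of the quotient graph: the `G`-orbits of edges. -/
abbrev EdgeOrbit : Type v := MulAction.orbitRel.Quotient G 𝒯.edgeSet

/-- The orbit of a vertex. -/
abbrev vertexOrbit (x : X) : VertexOrbit G X := Quotient.mk'' x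

variable {𝒯} in
/-- The orbit of an edge. -/
abbrev edgeOrbit (e : 𝒯.edgeSet) : EdgeOrbit G 𝒯 := Quotient.mk'' e

/-- The quotient graph `Y = 𝒯 / G`, a multigraph (loops and multiple edges may occur): the orbit
of an edge `{x, y}` joins the orbit of `x` to the orbit of `y`. -/
def quotientGraph : Graph (VertexOrbit G X) (EdgeOrbit G 𝒯) where
  vertexSet := Set.univ
  IsLink e v w := ∃ (x y : X) (h : 𝒯.Adj x y),
    edgeOrbit G ⟨s(x, y), h⟩ = e ∧ vertexOrbit G x = v ∧ vertexOrbit G y = w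
  isLink_symm := by
    rintro e -
    refine ⟨?_⟩
    rintro v w ⟨x, y, h, rfl, rfl, rfl⟩
    exact ⟨y, x, h.symm, congrArg _ (Subtype.ext Sym2.eq_swap), rfl, rfl⟩
  eq_or_eq_of_isLink_of_isLink := by
    rintro e v w v' w' ⟨x, y, h, rfl, rfl, rfl⟩ ⟨x', y', h', he, rfl, rfl⟩
    obtain ⟨g, hg⟩ := MulAction.orbitRel_apply.mp (Quotient.exact he.symm)
    have hg' : s(g • x', g • y') = s(x, y) := congrArg Subtype.val hg
    rcases Sym2.eq_iff.mp hg' with ⟨h1, -⟩ | ⟨-, h1⟩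
    · exact Or.inl (Quotient.sound (MulAction.orbitRel_apply.mpr ⟨g, h1⟩))
    · exact Or.inr (Quotient.sound (MulAction.orbitRel_apply.mpr ⟨g, h1⟩))
  left_mem_of_isLink := fun _ _ _ _ => Set.mem_univ _

end Quotient

/-- The choices made for an action of `G` on `𝒯` with quotient graph `Y`: a spanning tree `T` of
`Y`, a section `j` (given on vertices and on edges) of the quotient map `𝒯 → Y` which on `T` is an
isomorphism of graphs onto its image, an ordering `src e, tgt e` of the ends of each edge `e` of
`Y`, and elements `g_e` of `G` with `j e = {j (src e), g_e • j (tgt e)}`, where `g_e = 1` for the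
edges of `T`. -/
structure Choice (G : Type u) [Group G] {X : Type v} [MulAction G X] (𝒯 : SimpleGraph X)
    [ActsOnGraph G 𝒯] where
  /-- the spanning tree `T` -/
  T : Graph (VertexOrbit G X) (EdgeOrbit G 𝒯)
  T_spanning : T.IsSpanningSubgraph (quotientGraph G 𝒯)
  T_tree : IsMultigraphTree T
  /-- the section `j` on vertices -/
  jV : VertexOrbit G X → X
  vertexOrbit_jV : ∀ v, vertexOrbit G (jV v) = v
  /-- the section `j` on edges -/
  jE : EdgeOrbit G 𝒯 → 𝒯.edgeSet
  edgeOrbit_jE : ∀ e, edgeOrbit G (jE e) = e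
  /-- On `T` the section is a morphism of graphs. It is injective, because it is a section, hence
  an isomorphism of `T` onto a subgraph of `𝒯`. -/
  jE_of_isLink : ∀ e v w, T.IsLink e v w → (jE e : Sym2 X) = s(jV v, jV w)
  /-- the first end of an edge of `Y` -/
  src : EdgeOrbit G 𝒯 → VertexOrbit G X
  /-- the second end of an edge of `Y` -/
  tgt : EdgeOrbit G 𝒯 → VertexOrbit G X
  isLink_src_tgt : ∀ e, (quotientGraph G 𝒯).IsLink e (src e) (tgt e)
  /-- the elements `g_e` -/
  elt : EdgeOrbit G 𝒯 → G
  jE_eq : ∀ e, (jE e : Sym2 X) = s(jV (src e), elt e • jV (tgt e))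
  elt_eq_one : ∀ e ∈ T.edgeSet, elt e = 1

namespace Choice

variable {G : Type u} [Group G] {X : Type v} [MulAction G X] {𝒯 : SimpleGraph X}
  [ActsOnGraph G 𝒯] (D : Choice G 𝒯)

/-- The vertex group `G_v`, the stabilizer of the vertex `j v`. -/
def vertexGroup (v : VertexOrbit G X) : Subgroup G := MulAction.stabilizer G (D.jV v)

/-- The edge group `G_e`, the stabilizer of the edge `j e`. -/
def edgeGroup (e : EdgeOrbit G 𝒯) : Subgroup G := MulAction.stabilizer G (D.jE e)

/-- The union of the edge groups `G_e` of the edges `e` incident to `v`, as subsets of `G_v`: the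
edge group of `e` sits in the vertex group of `src e` by inclusion, and in the vertex group of
`tgt e` by `x ↦ g_e⁻¹ x g_e`. A loop at `v` contributes both images. -/
def incidentEdgeGroups (v : VertexOrbit G X) : Set G :=
  {x | ∃ e, D.src e = v ∧ x ∈ D.edgeGroup e} ∪
    {x | ∃ e, D.tgt e = v ∧ ∃ y ∈ D.edgeGroup e, x = (D.elt e)⁻¹ * y * D.elt e}

/-- The subgroup `K` of `G` generated by the elements `g_e`, for the edges `e` of `Y` outside `T`,
together with the sets `S_v`, for all vertices `v` of `Y`. -/
def generatedSubgroup (S : VertexOrbit G X → Set G) : Subgroup G :=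
  Subgroup.closure ({g | ∃ e, e ∉ D.T.edgeSet ∧ g = D.elt e} ∪ ⋃ v, S v)

/-- If the action is without inversions, the embedded edge groups are contained in the vertex
groups. -/
theorem incidentEdgeGroups_subset (h : WithoutInversions G 𝒯) (v : VertexOrbit G X) :
    D.incidentEdgeGroups v ⊆ D.vertexGroup v := by
  have key : ∀ (e : EdgeOrbit G 𝒯) (x : G), x ∈ D.edgeGroup e →
      x • D.jV (D.src e) = D.jV (D.src e) ∧
        x • D.elt e • D.jV (D.tgt e) = D.elt e • D.jV (D.tgt e) := by
    intro e x hx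
    have hadj : 𝒯.Adj (D.jV (D.src e)) (D.elt e • D.jV (D.tgt e)) := by
      have := (D.jE e).2
      rw [D.jE_eq e] at this
      exact this
    have hx' : Sym2.map (x • ·) (D.jE e : Sym2 X) = (D.jE e : Sym2 X) :=
      congrArg Subtype.val (MulAction.mem_stabilizer_iff.mp hx)
    rw [D.jE_eq e, Sym2.map_mk, Sym2.eq_iff] at hx'
    rcases hx' with h1 | h1
    · exact h1
    · exact absurd h1 (h x _ _ hadj)
  rintro x (⟨e, rfl, hx⟩ | ⟨e, rfl, y, hy, rfl⟩)
  · exact MulAction.mem_stabilizer_iff.mpr (key e x hx).1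
  · refine MulAction.mem_stabilizer_iff.mpr ?_
    rw [mul_smul, mul_smul, (key e y hy).2, inv_smul_smul]

end Choice

end BassSerre

/-! Let `H` be the subgroup generated by `S v₀` and the edge groups at `v₀`. Cutting the tree at `j
v₀` and grouping its branches by the left cosets of `H` in `G_{v₀}` gives disjoint sides, because an
element of `G_{v₀}` carrying one basic neighbour to another lies in an edge group, hence in `H`. Let
`A` be the set of `g` with `D.OnSide v₀ H v₀ g`; it contains 1.

`A` is invariant under right multiplication by `K` (`onSide_mul_iff`): the side does not change
within a translate of the spanning tree, nor across an edge outside it. Since `H ≠ G_{v₀} ≠ G`, a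
ping-pong choice gives `t` with `t A ⊆ A` and `t⁻¹ ∉ A` (`exists_onSide_mul`). If `K` had finite
index, some `t ^ n` with `n > 0` would lie in `K`, so `t⁻ⁿ ∈ A`; applying `t` repeatedly would give
`t⁻¹ ∈ A`. -/

/-- The vertices `y` that can be reached from the set `N` by a walk in `𝒯` avoiding `x₀`. For a
tree and a set `N` of neighbours of `x₀` this is the union of the branches at `x₀` through `N`. -/
inductive SimpleGraph.Branch {X : Type v} (𝒯 : SimpleGraph X) (x₀ : X) (N : Set X) : X → Prop
  | base {n : X} : n ∈ N → 𝒯.Branch x₀ N n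
  | step {y z : X} : 𝒯.Branch x₀ N y → 𝒯.Adj y z → z ≠ x₀ → 𝒯.Branch x₀ N z

/-! ### Branches of a graph at a vertex. -/

namespace SimpleGraph.Branch

variable {X : Type v} {𝒯 : SimpleGraph X} {x₀ : X} {N N' : Set X}

theorem ne (hN : ∀ n ∈ N, 𝒯.Adj x₀ n) {y : X} (h : 𝒯.Branch x₀ N y) : y ≠ x₀ := by
  cases h with
  | base h => exact (hN _ h).ne'
  | step _ _ h => exact h

theorem adj_iff {y z : X} (h : 𝒯.Adj y z) (hy : y ≠ x₀) (hz : z ≠ x₀) :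
    𝒯.Branch x₀ N y ↔ 𝒯.Branch x₀ N z :=
  ⟨fun k => step k h hz, fun k => step k h.symm hy⟩

theorem exists_branch_singleton {y : X} (h : 𝒯.Branch x₀ N y) : ∃ n ∈ N, 𝒯.Branch x₀ {n} y := by
  induction h with
  | base h => exact ⟨_, h, base rfl⟩
  | step _ h hz ih =>
    obtain ⟨n, hn, ih⟩ := ih
    exact ⟨n, hn, step ih h hz⟩

/-- A walk inside a branch never visits `x₀`, so it survives the deletion of any edge at `x₀`. -/
theorem reachable_deleteEdges (hN : ∀ n ∈ N, 𝒯.Adj x₀ n) {y : X} (h : 𝒯.Branch x₀ N y) :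
    ∃ n ∈ N, ∀ m, (𝒯.deleteEdges {s(x₀, m)}).Reachable n y := by
  induction h with
  | base h => exact ⟨_, h, fun _ => .rfl⟩
  | @step y z hy h hz ih =>
    obtain ⟨n, hn, ih⟩ := ih
    refine ⟨n, hn, fun m => (ih m).trans (SimpleGraph.Adj.reachable ?_)⟩
    rw [SimpleGraph.deleteEdges_adj]
    refine ⟨h, fun k => ?_⟩
    rcases Sym2.eq_iff.mp k with ⟨k, -⟩ | ⟨-, k⟩
    · exact hy.ne hN k
    · exact hz k

/-- Two unions of branches at a vertex of an acyclic graph that meet have a branch in common. -/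
theorem exists_mem_mem (h𝒯 : 𝒯.IsAcyclic) (hN : ∀ n ∈ N, 𝒯.Adj x₀ n)
    (hN' : ∀ n ∈ N', 𝒯.Adj x₀ n) {y : X} (h : 𝒯.Branch x₀ N y) (h' : 𝒯.Branch x₀ N' y) :
    ∃ n ∈ N, n ∈ N' := by
  obtain ⟨n, hn, h⟩ := h.reachable_deleteEdges hN
  obtain ⟨n', hn', h'⟩ := h'.reachable_deleteEdges hN'
  refine ⟨n, hn, ?_⟩
  by_contra hne
  have hb : 𝒯.IsBridge s(x₀, n) := SimpleGraph.isAcyclic_iff_forall_isBridge.mp h𝒯 (hN n hn)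
  rw [SimpleGraph.isBridge_iff] at hb
  -- If `n ∉ N'`, the route from `x₀` through `n'` and `y` to `n` bypasses the bridge `s(x₀, n)`.
  refine hb (Reachable.trans (SimpleGraph.Adj.reachable (v := n') ?_) ((h' n).trans (h n).symm))
  rw [SimpleGraph.deleteEdges_adj]
  refine ⟨hN' n' hn', fun k => ?_⟩
  rcases Sym2.eq_iff.mp k with ⟨-, k⟩ | ⟨k, -⟩
  · exact hne (k ▸ hn')
  · exact (hN n hn).ne k

theorem iff_mem_of_adj (h𝒯 : 𝒯.IsAcyclic) (hN : ∀ n ∈ N, 𝒯.Adj x₀ n) {y : X}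
    (hy : 𝒯.Adj x₀ y) : 𝒯.Branch x₀ N y ↔ y ∈ N := by
  refine ⟨fun h => ?_, base⟩
  obtain ⟨n, hn, rfl⟩ := h.exists_mem_mem (N' := {y}) h𝒯 hN (fun n hn => hn ▸ hy) (base rfl)
  exact hn

theorem of_connected (h : 𝒯.Connected) {y : X} (hy : y ≠ x₀) :
    𝒯.Branch x₀ (𝒯.neighborSet x₀) y := by
  obtain ⟨p⟩ := h.preconnected y x₀
  induction p with
  | nil => exact absurd rfl hy
  | @cons y z w hyz _ ih =>
    by_cases hz : z = w
    · exact base (hz ▸ hyz.symm)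
    · exact step (ih hz) hyz.symm hy

theorem smul {G : Type u} [Group G] [MulAction G X] [ActsOnGraph G 𝒯] {g : G}
    (hg : g • x₀ = x₀) (hN : ∀ n ∈ N, g • n ∈ N') {y : X} (h : 𝒯.Branch x₀ N y) :
    𝒯.Branch x₀ N' (g • y) := by
  induction h with
  | base h => exact base (hN _ h)
  | step _ h hz ih =>
    refine step ih (ActsOnGraph.adj_smul g h) fun k => hz ?_
    exact smul_left_cancel g (k.trans hg.symm)

/-- If `g • x₀` lies in a branch at `x₀` and the `g`-translate of the branch does not contain `x₀`,
then the translate is contained in the branch. -/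
theorem smul_of_forall_ne {G : Type u} [Group G] [MulAction G X] [ActsOnGraph G 𝒯] {g : G}
    (hN : ∀ n ∈ N, 𝒯.Adj x₀ n) (hg : 𝒯.Branch x₀ N' (g • x₀))
    (hne : ∀ y, 𝒯.Branch x₀ N y → g • y ≠ x₀) {y : X} (h : 𝒯.Branch x₀ N y) :
    𝒯.Branch x₀ N' (g • y) := by
  induction h with
  | base h => exact step hg (ActsOnGraph.adj_smul g (hN _ h)) (hne _ (base h))
  | step hy h hz ih => exact step ih (ActsOnGraph.adj_smul g h) (hne _ (step hy h hz))

end SimpleGraph.Branch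

/-! ### Neighbours of `j v` and cosets in the vertex group. -/

namespace BassSerre.Choice

variable {G : Type u} [Group G] {X : Type v} [MulAction G X] {𝒯 : SimpleGraph X}
  [ActsOnGraph G 𝒯] (D : Choice G 𝒯)

theorem adj_jV (e : EdgeOrbit G 𝒯) :
    𝒯.Adj (D.jV (D.src e)) (D.elt e • D.jV (D.tgt e)) := by
  have := (D.jE e).2
  rwa [D.jE_eq e] at this

theorem adj_smul_jV (e : EdgeOrbit G 𝒯) (g : G) :
    𝒯.Adj (g • D.jV (D.src e)) ((g * D.elt e) • D.jV (D.tgt e)) := by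
  rw [mul_smul]
  exact ActsOnGraph.adj_smul g (D.adj_jV e)

theorem coe_smul_jE (e : EdgeOrbit G 𝒯) (g : G) :
    ((g • D.jE e : 𝒯.edgeSet) : Sym2 X) =
      s(g • D.jV (D.src e), (g * D.elt e) • D.jV (D.tgt e)) := by
  change Sym2.map (g • ·) (D.jE e : Sym2 X) = _
  rw [D.jE_eq e, Sym2.map_mk, mul_smul]

theorem eq_of_smul_jV_eq {v w : VertexOrbit G X} {g h : G} (k : g • D.jV v = h • D.jV w) :
    v = w := by
  rw [← D.vertexOrbit_jV v, ← D.vertexOrbit_jV w]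
  refine Quotient.sound (MulAction.orbitRel_apply.mpr ⟨g⁻¹ * h, ?_⟩)
  change (g⁻¹ * h) • D.jV w = D.jV v
  rw [mul_smul, ← k, inv_smul_smul]

theorem eq_of_smul_jE_eq {e f : EdgeOrbit G 𝒯} {g h : G} (k : g • D.jE e = h • D.jE f) :
    e = f := by
  rw [← D.edgeOrbit_jE e, ← D.edgeOrbit_jE f]
  refine Quotient.sound (MulAction.orbitRel_apply.mpr ⟨g⁻¹ * h, ?_⟩)
  change (g⁻¹ * h) • D.jE f = D.jE e
  rw [mul_smul, ← k, inv_smul_smul]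

/-- An edge of `𝒯` is a translate of an edge in the image of `j`. -/
theorem exists_smul_jE_eq {x y : X} (h : 𝒯.Adj x y) :
    ∃ (e : EdgeOrbit G 𝒯) (g : G),
      s(x, y) = s(g • D.jV (D.src e), (g * D.elt e) • D.jV (D.tgt e)) := by
  let ε : 𝒯.edgeSet := ⟨s(x, y), h⟩
  obtain ⟨g, hg⟩ := MulAction.orbitRel_apply.mp
    (Quotient.exact (D.edgeOrbit_jE (edgeOrbit G ε)).symm)
  refine ⟨edgeOrbit G ε, g, ?_⟩
  rw [← D.coe_smul_jE]
  exact (congrArg Subtype.val hg).symm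

/-- The neighbours of `j v` at the far ends of the translates of the edges `j e` chosen for the
edges `e` of `Y` incident to `v`. -/
def basicNeighbors (v : VertexOrbit G X) : Set X :=
  {x | ∃ e, D.src e = v ∧ x = D.elt e • D.jV (D.tgt e)} ∪
    {x | ∃ e, D.tgt e = v ∧ x = (D.elt e)⁻¹ • D.jV (D.src e)}

/-- The translates of the basic neighbours of `j v` by the elements of `H`. -/
def neighborClass (v : VertexOrbit G X) (H : Subgroup G) : Set X :=
  {x | ∃ h ∈ H, ∃ n ∈ D.basicNeighbors v, x = h • n}

theorem adj_of_mem_basicNeighbors {v : VertexOrbit G X} {n : X} (hn : n ∈ D.basicNeighbors v) :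
    𝒯.Adj (D.jV v) n := by
  rcases hn with ⟨e, rfl, rfl⟩ | ⟨e, rfl, rfl⟩
  · exact D.adj_jV e
  · have := D.adj_smul_jV e (D.elt e)⁻¹
    rw [inv_mul_cancel, one_smul] at this
    exact this.symm

theorem adj_of_mem_neighborClass {v : VertexOrbit G X} {H : Subgroup G}
    (hH : H ≤ D.vertexGroup v) {n : X} (hn : n ∈ D.neighborClass v H) : 𝒯.Adj (D.jV v) n := by
  obtain ⟨h, hh, n, hn, rfl⟩ := hn
  have := ActsOnGraph.adj_smul h (D.adj_of_mem_basicNeighbors hn)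
  rwa [MulAction.mem_stabilizer_iff.mp (hH hh)] at this

theorem exists_smul_basicNeighbor_eq {v : VertexOrbit G X} {y : X} (hy : 𝒯.Adj (D.jV v) y) :
    ∃ a ∈ D.vertexGroup v, ∃ n ∈ D.basicNeighbors v, y = a • n := by
  obtain ⟨e, g, h⟩ := D.exists_smul_jE_eq hy
  rcases Sym2.eq_iff.mp h with ⟨h1, h2⟩ | ⟨h1, h2⟩
  · obtain rfl : v = D.src e :=
      D.eq_of_smul_jV_eq (g := 1) (h := g) (by rw [one_smul, h1])
    exact ⟨g, MulAction.mem_stabilizer_iff.mpr h1.symm, _, Or.inl ⟨e, rfl, rfl⟩,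
      by rw [h2, mul_smul]⟩
  · obtain rfl : v = D.tgt e :=
      D.eq_of_smul_jV_eq (g := 1) (h := g * D.elt e) (by rw [one_smul, h1])
    exact ⟨g * D.elt e, MulAction.mem_stabilizer_iff.mpr h1.symm, _, Or.inr ⟨e, rfl, rfl⟩,
      by rw [h2, smul_smul, mul_inv_cancel_right]⟩

/-- An element of the vertex group that maps a basic neighbour to a basic neighbour is in an edge
group. -/
theorem mem_incidentEdgeGroups (h_inv : WithoutInversions G 𝒯) {v : VertexOrbit G X} {a : G}
    (ha : a ∈ D.vertexGroup v) {n m : X} (hn : n ∈ D.basicNeighbors v)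
    (hm : m ∈ D.basicNeighbors v) (hnm : a • n = m) : a ∈ D.incidentEdgeGroups v := by
  have ha : a • D.jV v = D.jV v := MulAction.mem_stabilizer_iff.mp ha
  -- An outgoing and an incoming basic edge cannot be matched: both would be the same edge of `Y`,
  -- and `g_e b` would invert `j e`.
  have swap : ∀ (e f : EdgeOrbit G 𝒯) (b : G), b • D.jV (D.src e) = D.jV (D.tgt f) →
      b • D.elt e • D.jV (D.tgt e) = (D.elt f)⁻¹ • D.jV (D.src f) → False := by
    intro e f b h1 h2
    have key : b • D.jE e = (D.elt f)⁻¹ • D.jE f := by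
      refine Subtype.ext ?_
      rw [D.coe_smul_jE, D.coe_smul_jE, mul_smul, h1, h2, inv_mul_cancel, one_smul, Sym2.eq_swap]
    obtain rfl := D.eq_of_smul_jE_eq key
    refine h_inv (D.elt e * b) _ _ (D.adj_jV e) ⟨?_, ?_⟩
    · rw [mul_smul, h1]
    · rw [mul_smul, h2, smul_inv_smul]
  rcases hn with ⟨e, rfl, rfl⟩ | ⟨e, rfl, rfl⟩ <;> rcases hm with ⟨f, hf, rfl⟩ | ⟨f, hf, rfl⟩
  · have key : a • D.jE e = (1 : G) • D.jE f := by
      refine Subtype.ext ?_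
      rw [D.coe_smul_jE, D.coe_smul_jE, mul_smul, hnm, ha, one_smul, one_mul, hf]
    obtain rfl := D.eq_of_smul_jE_eq key
    rw [one_smul] at key
    exact Or.inl ⟨e, rfl, MulAction.mem_stabilizer_iff.mpr key⟩
  · exact (swap e f a (by rw [ha, hf]) hnm).elim
  · refine (swap f e a⁻¹ (by rw [hf, inv_smul_eq_iff, ha]) ?_).elim
    rw [← hnm, inv_smul_smul]
  · have key : (a * (D.elt e)⁻¹) • D.jE e = (D.elt f)⁻¹ • D.jE f := by
      refine Subtype.ext ?_
      rw [D.coe_smul_jE, D.coe_smul_jE, mul_smul, hnm, inv_mul_cancel_right, inv_mul_cancel,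
        one_smul, hf, ha]
    obtain rfl := D.eq_of_smul_jE_eq key
    refine Or.inr ⟨e, rfl, D.elt e * a * (D.elt e)⁻¹, MulAction.mem_stabilizer_iff.mpr ?_, by group⟩
    rw [mul_assoc, mul_smul, key, smul_inv_smul]

/-- This makes the neighbour classes of distinct left cosets of `H` disjoint. -/
theorem mem_of_smul_mem_neighborClass (h_inv : WithoutInversions G 𝒯) {v : VertexOrbit G X}
    {H : Subgroup G} (hH : H ≤ D.vertexGroup v) (hE : D.incidentEdgeGroups v ⊆ H) {a : G}
    (ha : a ∈ D.vertexGroup v) {n : X} (hn : n ∈ D.neighborClass v H)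
    (hn' : a • n ∈ D.neighborClass v H) : a ∈ H := by
  obtain ⟨h, hh, n, hn, rfl⟩ := hn
  obtain ⟨k, hk, m, hm, e⟩ := hn'
  have : k⁻¹ * a * h ∈ H := hE <| D.mem_incidentEdgeGroups h_inv
    (mul_mem (mul_mem (inv_mem (hH hk)) ha) (hH hh)) hn hm (by
      rw [mul_assoc, mul_smul, mul_smul, e, inv_smul_smul])
  rw [Subgroup.mul_mem_cancel_right _ hh, Subgroup.mul_mem_cancel_left _ (inv_mem hk)] at this
  exact this

/-- The translate `g • j v` lies on the side of `H` seen from `j v₀`: in one of the branches at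
`j v₀` through the class of `H`, or at `j v₀` itself with `g ∈ H`. -/
def OnSide (v₀ : VertexOrbit G X) (H : Subgroup G) (v : VertexOrbit G X) (g : G) : Prop :=
  𝒯.Branch (D.jV v₀) (D.neighborClass v₀ H) (g • D.jV v) ∨ (v = v₀ ∧ g ∈ H)

/-! ### The side of `H` and its invariance. -/

section Side

variable {v₀ : VertexOrbit G X} {H : Subgroup G}

theorem onSide_of_smul_ne (hH : H ≤ D.vertexGroup v₀) {v : VertexOrbit G X} {g : G}
    (h : g • D.jV v ≠ D.jV v₀) :
    D.OnSide v₀ H v g ↔ 𝒯.Branch (D.jV v₀) (D.neighborClass v₀ H) (g • D.jV v) := by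
  refine or_iff_left ?_
  rintro ⟨rfl, hg⟩
  exact h (MulAction.mem_stabilizer_iff.mp (hH hg))

theorem onSide_of_mem_vertexGroup (hH : H ≤ D.vertexGroup v₀) {g : G}
    (h : g • D.jV v₀ = D.jV v₀) : D.OnSide v₀ H v₀ g ↔ g ∈ H := by
  refine ⟨?_, fun k => Or.inr ⟨rfl, k⟩⟩
  rintro (k | ⟨-, k⟩)
  · exact absurd h (k.ne fun n hn => D.adj_of_mem_neighborClass hH hn)
  · exact k

/-- Away from `j v₀` the two ends of an edge share a branch. If one end is `j v₀`, the vertex alone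
does not determine a side; the coset of the group element does, and it matches the class of the
other end. -/
theorem onSide_src_iff (h_tree : 𝒯.IsTree) (h_inv : WithoutInversions G 𝒯)
    (hH : H ≤ D.vertexGroup v₀) (hE : D.incidentEdgeGroups v₀ ⊆ H) (e : EdgeOrbit G 𝒯) (g : G) :
    D.OnSide v₀ H (D.src e) g ↔ D.OnSide v₀ H (D.tgt e) (g * D.elt e) := by
  have hN : ∀ n ∈ D.neighborClass v₀ H, 𝒯.Adj (D.jV v₀) n :=
    fun n hn => D.adj_of_mem_neighborClass hH hn
  have hadj := D.adj_smul_jV e g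
  have aux : ∀ {a : G} {n : X}, a • D.jV v₀ = D.jV v₀ → n ∈ D.basicNeighbors v₀ →
      (a ∈ H ↔ a • n ∈ D.neighborClass v₀ H) := fun {a n} ha hn =>
    ⟨fun h => ⟨a, h, n, hn, rfl⟩, D.mem_of_smul_mem_neighborClass h_inv hH hE
      (MulAction.mem_stabilizer_iff.mpr ha) ⟨1, one_mem H, n, hn, (one_smul G n).symm⟩⟩
  by_cases h1 : g • D.jV (D.src e) = D.jV v₀
  · obtain rfl : D.src e = v₀ := D.eq_of_smul_jV_eq (h := 1) (by rw [h1, one_smul])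
    rw [h1] at hadj
    rw [D.onSide_of_mem_vertexGroup hH h1, D.onSide_of_smul_ne hH hadj.ne',
      SimpleGraph.Branch.iff_mem_of_adj h_tree.isAcyclic hN hadj, aux h1 (Or.inl ⟨e, rfl, rfl⟩),
      mul_smul]
  · by_cases h2 : (g * D.elt e) • D.jV (D.tgt e) = D.jV v₀
    · obtain rfl : D.tgt e = v₀ := D.eq_of_smul_jV_eq (h := 1) (by rw [h2, one_smul])
      rw [h2] at hadj
      rw [D.onSide_of_mem_vertexGroup hH h2, D.onSide_of_smul_ne hH h1,
        SimpleGraph.Branch.iff_mem_of_adj h_tree.isAcyclic hN hadj.symm,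
        aux h2 (Or.inr ⟨e, rfl, rfl⟩), smul_smul, mul_inv_cancel_right]
    · rw [D.onSide_of_smul_ne hH h1, D.onSide_of_smul_ne hH h2]
      exact SimpleGraph.Branch.adj_iff hadj h1 h2

/-- The side of a translate of the spanning tree is well defined. -/
theorem onSide_iff (h_tree : 𝒯.IsTree) (h_inv : WithoutInversions G 𝒯)
    (hH : H ≤ D.vertexGroup v₀) (hE : D.incidentEdgeGroups v₀ ⊆ H) (v w : VertexOrbit G X)
    (g : G) : D.OnSide v₀ H v g ↔ D.OnSide v₀ H w g := by
  have hV : ∀ u, u ∈ D.T.vertexSet := fun u => by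
    rw [D.T_spanning.vertexSet_eq]
    exact Set.mem_univ u
  obtain ⟨p⟩ := D.T_tree.isTree.connected.preconnected ⟨v, hV v⟩ ⟨w, hV w⟩
  suffices ∀ (a b : D.T.vertexSet), D.T.toSimpleGraph.Walk a b →
      (D.OnSide v₀ H a g ↔ D.OnSide v₀ H b g) from this _ _ p
  intro a b p
  induction p with
  | nil => exact Iff.rfl
  | @cons a b c hab _ ih =>
    refine Iff.trans ?_ ih
    obtain ⟨-, e, he⟩ := hab
    -- On `T` the element `g_e` is 1, so crossing the edge leaves `g` unchanged.
    have hs := D.onSide_src_iff h_tree h_inv hH hE e g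
    rw [D.elt_eq_one e he.edge_mem, mul_one] at hs
    rcases (he.mono D.T_spanning.le).eq_and_eq_or_eq_and_eq (D.isLink_src_tgt e) with
      ⟨h1, h2⟩ | ⟨h1, h2⟩
    · rw [h1, h2, hs]
    · rw [h1, h2, hs]

/-- The side of `H` is invariant under right multiplication by the subgroup `K`. -/
theorem onSide_mul_iff (h_tree : 𝒯.IsTree) (h_inv : WithoutInversions G 𝒯)
    (hH : H ≤ D.vertexGroup v₀) (hE : D.incidentEdgeGroups v₀ ⊆ H)
    {S : VertexOrbit G X → Set G} (hS : ∀ v, S v ⊆ D.vertexGroup v) (hS₀ : S v₀ ⊆ H) {k : G}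
    (hk : k ∈ D.generatedSubgroup S) (g : G) :
    D.OnSide v₀ H v₀ (g * k) ↔ D.OnSide v₀ H v₀ g := by
  have indep := D.onSide_iff h_tree h_inv hH hE
  induction hk using Subgroup.closure_induction generalizing g with
  | mem s hs =>
    rcases hs with ⟨e, -, rfl⟩ | hs
    · rw [indep v₀ (D.tgt e), ← D.onSide_src_iff h_tree h_inv hH hE, indep v₀]
    · obtain ⟨v, hs⟩ := Set.mem_iUnion.mp hs
      -- Since `s` fixes `j v`, the branch condition is unchanged; only `v = v₀` needs `S v₀ ⊆ H`.
      rw [indep v₀ v, indep v₀ v, OnSide, OnSide, mul_smul,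
        MulAction.mem_stabilizer_iff.mp (hS v hs)]
      refine or_congr Iff.rfl (and_congr_right ?_)
      rintro rfl
      exact Subgroup.mul_mem_cancel_right _ (hS₀ hs)
  | one => rw [mul_one]
  | mul a b _ _ iha ihb => exact mul_assoc g a b ▸ (ihb (g * a)).trans (iha g)
  | inv a _ ih => simpa using (ih (g * a⁻¹)).symm

/-- Every vertex other than `j v₀` can be moved by `G_{v₀}` into the branches of `H`. -/
theorem exists_branch_smul (h_tree : 𝒯.IsTree) {y : X} (hy : y ≠ D.jV v₀) :
    ∃ a ∈ D.vertexGroup v₀, 𝒯.Branch (D.jV v₀) (D.neighborClass v₀ H) (a • y) := by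
  obtain ⟨m, hm, h⟩ :=
    (SimpleGraph.Branch.of_connected h_tree.connected hy).exists_branch_singleton
  obtain ⟨a, ha, n, hn, rfl⟩ := D.exists_smul_basicNeighbor_eq hm
  refine ⟨a⁻¹, inv_mem ha, h.smul (MulAction.mem_stabilizer_iff.mp (inv_mem ha)) ?_⟩
  rintro _ rfl
  exact ⟨1, one_mem H, n, hn, by rw [inv_smul_smul, one_smul]⟩

/-- The translates of the branches of `H` by elements of `G_{v₀}` outside `H` are disjoint from
them. -/
theorem mem_of_branch_smul (h_tree : 𝒯.IsTree) (h_inv : WithoutInversions G 𝒯)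
    (hH : H ≤ D.vertexGroup v₀) (hE : D.incidentEdgeGroups v₀ ⊆ H) {a : G}
    (ha : a ∈ D.vertexGroup v₀) {y : X} (hy : 𝒯.Branch (D.jV v₀) (D.neighborClass v₀ H) y)
    (hay : 𝒯.Branch (D.jV v₀) (D.neighborClass v₀ H) (a • y)) : a ∈ H := by
  have hN : ∀ n ∈ D.neighborClass v₀ H, 𝒯.Adj (D.jV v₀) n :=
    fun n hn => D.adj_of_mem_neighborClass hH hn
  have ha' := MulAction.mem_stabilizer_iff.mp ha
  obtain ⟨_, hm, n, hn, rfl⟩ := hay.exists_mem_mem (N' := (a • ·) '' D.neighborClass v₀ H)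
    h_tree.isAcyclic hN (by
      rintro _ ⟨n, hn, rfl⟩
      have := ActsOnGraph.adj_smul a (hN n hn)
      rwa [ha'] at this) (hy.smul ha' fun n hn => Set.mem_image_of_mem _ hn)
  exact D.mem_of_smul_mem_neighborClass h_inv hH hE ha hn hm

/-- Some element of `G` maps the side of `H` properly into itself. -/
theorem exists_onSide_mul (h_tree : 𝒯.IsTree) (h_inv : WithoutInversions G 𝒯)
    (hH : H < D.vertexGroup v₀) (hE : D.incidentEdgeGroups v₀ ⊆ H)
    (h_ne : D.vertexGroup v₀ < ⊤) :
    ∃ t : G, (∀ g, D.OnSide v₀ H v₀ g → D.OnSide v₀ H v₀ (t * g)) ∧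
      ¬ D.OnSide v₀ H v₀ t⁻¹ := by
  have hN : ∀ n ∈ D.neighborClass v₀ H, 𝒯.Adj (D.jV v₀) n :=
    fun n hn => D.adj_of_mem_neighborClass hH.le hn
  obtain ⟨c, hc, hcH⟩ := SetLike.exists_of_lt hH
  obtain ⟨g, -, hg⟩ := SetLike.exists_of_lt h_ne
  have hg : g • D.jV v₀ ≠ D.jV v₀ := fun h => hg (MulAction.mem_stabilizer_iff.mpr h)
  obtain ⟨a, ha, hag⟩ := D.exists_branch_smul (H := H) h_tree hg
  have hg' : (a * g)⁻¹ • D.jV v₀ ≠ D.jV v₀ := fun h => by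
    rw [inv_smul_eq_iff, mul_smul] at h
    exact hag.ne hN h.symm
  obtain ⟨b, hb, hbg⟩ := D.exists_branch_smul (H := H) h_tree hg'
  have hc' : c • D.jV v₀ = D.jV v₀ := MulAction.mem_stabilizer_iff.mp hc
  have hb' : b⁻¹ • D.jV v₀ = D.jV v₀ := MulAction.mem_stabilizer_iff.mp (inv_mem hb)
  -- The factors `a` and `b` bring `g • j v₀` and `(a * g)⁻¹ • j v₀` into the branches of `H`; the
  -- factor `c ∉ H` then moves `t⁻¹ • j v₀` out of them without affecting `t • j v₀`.
  obtain ⟨t, ht⟩ : ∃ t, t = a * g * b⁻¹ * c := ⟨_, rfl⟩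
  have htx : t • D.jV v₀ = a • g • D.jV v₀ := by
    rw [ht, mul_smul, mul_smul, mul_smul, hc', hb']
  have htb : 𝒯.Branch (D.jV v₀) (D.neighborClass v₀ H) (t • D.jV v₀) := htx ▸ hag
  have hinv : c • t⁻¹ • D.jV v₀ = b • (a * g)⁻¹ • D.jV v₀ := by
    rw [smul_smul, smul_smul, ht]
    congr 1
    group
  have hnot : ¬ 𝒯.Branch (D.jV v₀) (D.neighborClass v₀ H) (t⁻¹ • D.jV v₀) := fun h =>
    hcH (D.mem_of_branch_smul h_tree h_inv hH.le hE hc h (hinv ▸ hbg))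
  refine ⟨t, ?_, ?_⟩
  · rintro k (hk | ⟨-, hk⟩) <;> left <;> rw [mul_smul]
    · refine SimpleGraph.Branch.smul_of_forall_ne hN htb (fun y hy h => hnot ?_) hk
      rwa [eq_inv_smul_iff.mpr h] at hy
    · rwa [MulAction.mem_stabilizer_iff.mp (hH.le hk)]
  · rintro (h | ⟨-, h⟩)
    · exact hnot h
    · exact htb.ne hN (MulAction.mem_stabilizer_iff.mp (hH.le (inv_mem_iff.mp h)))

end Side

end BassSerre.Choice

theorem mainTheorem8 {G : Type*} [Group G] {X : Type*} [MulAction G X] (𝒯 : SimpleGraph X)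
    [ActsOnGraph G 𝒯] (h_tree : 𝒯.IsTree) (h_inv : WithoutInversions G 𝒯)
    (D : BassSerre.Choice G 𝒯)
    (S : BassSerre.VertexOrbit G X → Set G) (hS : ∀ v, S v ⊆ D.vertexGroup v)
    (v₀ : BassSerre.VertexOrbit G X)
    (h_lt : Subgroup.closure (S v₀ ∪ D.incidentEdgeGroups v₀) < D.vertexGroup v₀)
    (h_ne : D.vertexGroup v₀ < ⊤) :
    Infinite (G ⧸ D.generatedSubgroup S) := by
  have hS₀ : S v₀ ⊆ Subgroup.closure (S v₀ ∪ D.incidentEdgeGroups v₀) :=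
    Set.subset_union_left.trans Subgroup.subset_closure
  have hE : D.incidentEdgeGroups v₀ ⊆ Subgroup.closure (S v₀ ∪ D.incidentEdgeGroups v₀) :=
    Set.subset_union_right.trans Subgroup.subset_closure
  generalize Subgroup.closure (S v₀ ∪ D.incidentEdgeGroups v₀) = H at h_lt hS₀ hE
  obtain ⟨t, ht, ht'⟩ := D.exists_onSide_mul h_tree h_inv h_lt hE h_ne
  by_contra hfin
  rw [not_infinite_iff_finite] at hfin
  obtain ⟨n, hn, -, hk⟩ := Subgroup.exists_pow_mem_of_index_ne_zero
    (Subgroup.finiteIndex_of_finite_quotient (H := D.generatedSubgroup S)).index_ne_zero t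
  have h_pow : D.OnSide v₀ H v₀ (t ^ n)⁻¹ := by
    rw [← D.onSide_mul_iff h_tree h_inv h_lt.le hE hS hS₀ hk, inv_mul_cancel]
    exact Or.inr ⟨rfl, one_mem H⟩
  -- Only `h_pow` may vary with `n`: membership in `K` would not pass down to smaller powers.
  clear hk
  induction n, hn using Nat.le_induction with
  | base => exact ht' (by simpa using h_pow)
  | succ n _ ih =>
    refine ih ?_
    have := ht _ h_pow
    rwa [pow_succ, mul_inv_rev, mul_inv_cancel_left] at this
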